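/- Let $N$ base stations with measurable cells $\mathcal C_1,\dots,\mathcal C_N\subset\mathbb R^2$ of finite area be given such that $|\mathcal C_i\cap(\bigcup_{j\ne i}\mathcal C_j)^c|>0$ for every $i$. For $s\subseteq\{1,\dots,N\}$ let $\mathcal C(s)=(\bigcap_{j\in s}\mathcal C_j)\cap(\bigcup_{j\notin s}\mathcal C_j)^c$. For each content $i\in\{1,\dots,M\}$, requests for content $i$ form a homogeneous Poisson point process in space $\bigcup_j\mathcal C_j$ and time $[0,\infty)$ with intensity $\lambda_i>0$ per unit area and unit time, independently for different contents. Every cache stores exactly $K<M$ contents; let $\mathcal B$ be the set of matrices $B\in\{0,1\}^{M\times N}$ all of whose columns sum to $K$ ($B_{i,j}=1$ meaning that base station $j$ stores content $i$), and for $B\in\mathcal B$ let $$h(B)=\sum_{s\subseteq\{1,\dots,N\}}|\mathcal C(s)|\sum_{i=1}^M\lambda_i\,\mathbf 1\Big\{\sum_{j\in s}B_{i,j}\ge 1\Big\},\qquad \pi_\beta(B)=\frac{e^{\beta h(B)}}{\sum_{B'\in\mathcal B}e^{\beta h(B')}},$$ where $\beta\in\mathbb R$ is fixed (the term $s=\emptyset$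 is zero). Virtual caches: $V(0)\in\mathcal B$ is arbitrary; at each time $t=1,2,\dots$ a base station $j_t$ is picked uniformly at random, independently of the past $(V(u),j_u)_{u<t}$, and then $V(t)$ is drawn, given this past and $j_t$, from $\pi_\beta(\,\cdot\mid V_{\cdot,-j_t}(t-1))$, the conditional distribution under $\pi_\beta$ of the configuration given that all its columns except the $j_t$-th agree with those of $V(t-1)$. Put $V(\tau)=V(t)$ for real $\tau\in[t,t+1)$, and $V(0-)=V(0)$. Real caches: let $0<T_1\le T_2\le\cdots$ with $T_k\to\infty$, $S_l=T_1+\cdots+T_l$ (so $S_0=0$), $\kappa(\tau)=\sup\{l\ge 0:S_l\le\tau\}$ and $\zeta(\tau)=S_{\kappa(\tau)}$. The real caches start from an arbitrary $R(0)\in\mathcal B$ and change only at request times. A request for content $i$ at time $\tau$ is served by a base station $j$ that covers its location and that stores content $i$ if some base station covering the location does; subject to this, the choice of $j$ is arbitrary (for instance, uniformly random). If $j$ does not have content $i$ in its real cache and $V_{i,j}(\zeta(\tau)-)=1$, then $i$ is stored in the real cache of $j$ in place of one (arbitrarily chosen) content $k\neq i$ with $R_{k,j}=1$ just before $\tau$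 and $V_{k,j}(\zeta(\tau)-)=0$; in all other cases the real caches do not change. Let $R(\tau)\in\mathcal B$ be the configuration of the real caches at time $\tau$. Then, for every $B\in\mathcal B$, the function $\tau\mapsto\mathbf P(R(\tau)=B)$ is integrable on bounded intervals of $[0,\infty)$ and $$\lim_{T\to\infty}\frac1T\int_0^T\mathbf P(R(\tau)=B)\,d\tau=\pi_\beta(B).$$ -/

import Mathlib

open Set Filter Topology MeasureTheory ProbabilityTheory

namespace CellularCaching

noncomputable section

/-- The plane in which base stations and users are located. -/
abbrev Plane : Type := EuclideanSpace ℝ (Fin 2)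

/-- Feasible content placements for `N` base stations, `M` contents and caches of size `K`.
The set `B j` is the support of the `j`-th column of the `0`-`1` matrix `B`:
the entry `B_{i,j}` equals `1` iff `i ∈ (B j).1`; every column has exactly `K` ones. -/
abbrev Config (N M K : ℕ) : Type := Fin N → {S : Finset (Fin M) // S.card = K}

/-- The region covered by all the base stations in `s` and by no other one. -/
def region {N : ℕ} (C : Fin N → Set Plane) (s : Finset (Fin N)) : Set Plane :=
  (⋂ j ∈ s, C j) ∩ (⋃ j ∈ sᶜ, C j)ᶜ

open Classical in
/-- The network-wide cache hit rate `h(B)` of the configuration `B`. -/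
def hitRate {N M K : ℕ} (C : Fin N → Set Plane) (rate : Fin M → ℝ) (B : Config N M K) : ℝ :=
  ∑ s : Finset (Fin N), (volume (region C s)).toReal *
    ∑ i : Fin M, rate i * (if ∃ j ∈ s, i ∈ (B j).1 then 1 else 0)

/-- The Gibbs distribution `π_β` on configurations. -/
def gibbs {N M K : ℕ} (C : Fin N → Set Plane) (rate : Fin M → ℝ) (β : ℝ)
    (B : Config N M K) : ℝ :=
  Real.exp (β * hitRate C rate B) / ∑ B' : Config N M K, Real.exp (β * hitRate C rate B')

open Classical in
/-- The conditional probability `π_β(A | B_{·,-j})` of the configuration `A` under `π_β`, given that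
all the columns except the `j`-th one agree with those of `B`. -/
def gibbsCond {N M K : ℕ} (C : Fin N → Set Plane) (rate : Fin M → ℝ) (β : ℝ)
    (B : Config N M K) (j : Fin N) (A : Config N M K) : ℝ :=
  if ∀ n, n ≠ j → A n = B n then
    gibbs C rate β A /
      ∑ A' : Config N M K, if ∀ n, n ≠ j → A' n = B n then gibbs C rate β A' else 0
  else 0

/-- Virtual caches updated by Gibbs sampling: at every discrete time `t + 1`, whatever the past,
a base station `J (t + 1)` is picked uniformly, and then the new configuration `V (t + 1)` is drawn
from `π_β(· | V_{·,-J (t+1)}(t))`. The initial configuration `V 0` is arbitrary (`J 0` plays no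
role). -/
structure IsVirtualCacheProcess {N M K : ℕ} {Ω : Type*} [MeasurableSpace Ω] (P : Measure Ω)
    (C : Fin N → Set Plane) (rate : Fin M → ℝ) (β : ℝ)
    (J : ℕ → Ω → Fin N) (V : ℕ → Ω → Config N M K) : Prop where
  measurableSet_node : ∀ t j, MeasurableSet {ω | J t ω = j}
  measurableSet_config : ∀ t B, MeasurableSet {ω | V t ω = B}
  step : ∀ (t : ℕ) (j : ℕ → Fin N) (v : ℕ → Config N M K),
    P.real {ω | (∀ u ≤ t + 1, V u ω = v u) ∧ ∀ u, 1 ≤ u → u ≤ t + 1 → J u ω = j u} =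
      P.real {ω | (∀ u ≤ t, V u ω = v u) ∧ ∀ u, 1 ≤ u → u ≤ t → J u ω = j u} *
        ((1 / (N : ℝ)) * gibbsCond C rate β (v t) (j (t + 1)) (v (t + 1)))

/-- The number of requests for content `i` whose (time, location) falls in `A`. -/
def requestCount {M : ℕ} {Ω : Type*} (time : ℕ → Ω → ℝ) (loc : ℕ → Ω → Plane)
    (content : ℕ → Ω → Fin M) (i : Fin M) (A : Set (ℝ × Plane)) (ω : Ω) : ℕ∞ :=
  Set.encard {n | content n ω = i ∧ (time n ω, loc n ω) ∈ A}

/-- The intensity measure of the requests for a content with rate `r` per unit time and unit area: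
`r` times Lebesgue measure on `[0, ∞) × ⋃ j, C j`. -/
def requestIntensity {N : ℕ} (C : Fin N → Set Plane) (r : ℝ) : Measure (ℝ × Plane) :=
  ENNReal.ofReal r •
    ((volume.restrict (Ici (0 : ℝ))).prod (volume.restrict (⋃ j, C j)))

/-- The request process: for each content `i`, the requests form a homogeneous Poisson point process
of intensity `rate i` in time `[0, ∞)` and space `⋃ j, C j`, and the processes of different contents
are independent. The `n`-th request over all contents, in the order of arrival, occurs at
time `time n`, at the location `loc n`, for the content `content n`. -/
structure IsPoissonRequestProcess {N M : ℕ} {Ω : Type*} [MeasurableSpace Ω] (P : Measure Ω)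
    (C : Fin N → Set Plane) (rate : Fin M → ℝ)
    (time : ℕ → Ω → ℝ) (loc : ℕ → Ω → Plane) (content : ℕ → Ω → Fin M) : Prop where
  measurable_time : ∀ n, Measurable (time n)
  measurable_loc : ∀ n, Measurable (loc n)
  measurable_content : ∀ n, Measurable (content n)
  ordered : ∀ᵐ ω ∂P, StrictMono (fun n => time n ω) ∧ Tendsto (fun n => time n ω) atTop atTop
  poisson : ∀ (i : Fin M) (A : Set (ℝ × Plane)), MeasurableSet A →
    requestIntensity C (rate i) A ≠ ⊤ → ∀ k : ℕ,
      P {ω | requestCount time loc content i A ω = k} =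
        poissonMeasure (requestIntensity C (rate i) A).toNNReal {k}
  indep : ∀ (m : ℕ) (i : Fin m → Fin M) (A : Fin m → Set (ℝ × Plane)),
    (∀ k, MeasurableSet (A k)) →
    (∀ k l, k ≠ l → i k ≠ i l ∨ Disjoint (A k) (A l)) →
      iIndepFun (fun k ω => requestCount time loc content (i k) (A k) ω) P

/-- The partial sums `S_l = T_1 + ⋯ + T_l`, where `T k` stands for `T_{k+1}`. -/
def epoch (T : ℕ → ℝ) (l : ℕ) : ℝ := ∑ k ∈ Finset.range l, T k

/-- `ζ(τ) = S_{κ(τ)}` with `κ(τ) = sup {l : S_l ≤ τ}`. -/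
def lastEpoch (T : ℕ → ℝ) (τ : ℝ) : ℝ := epoch T (sSup {l : ℕ | epoch T l ≤ τ})

/-- The continuous-time version of a discrete-time path: `V(τ) = V(t)` for `τ ∈ [t, t + 1)`. -/
def pathAt {X : Type*} (V : ℕ → X) (τ : ℝ) : X := V ⌊τ⌋₊

/-- The left limit `V(τ-)` of `pathAt V` at `τ > 0`; by convention `V(0-) = V(0)`. -/
def pathLeft {X : Type*} (V : ℕ → X) (τ : ℝ) : X := V (⌈τ⌉₊ - 1)

theorem eventually_pathAt_eq_pathLeft {X : Type*} (V : ℕ → X) {τ : ℝ} (hτ : 0 < τ) :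
    ∀ᶠ u in 𝓝[<] τ, pathAt V u = pathLeft V τ := by
  have hc : 0 < ⌈τ⌉₊ := Nat.ceil_pos.mpr hτ
  have hlt : ((⌈τ⌉₊ - 1 : ℕ) : ℝ) < τ := Nat.lt_ceil.mp (by omega)
  filter_upwards [Ioo_mem_nhdsLT hlt] with u hu
  have h1 : ⌊u⌋₊ = ⌈τ⌉₊ - 1 := by
    refine (Nat.floor_eq_iff (le_trans (Nat.cast_nonneg _) hu.1.le)).mpr ⟨hu.1.le, ?_⟩
    have h2 : (((⌈τ⌉₊ - 1 : ℕ) : ℝ)) + 1 = (⌈τ⌉₊ : ℝ) := by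
      exact_mod_cast Nat.sub_add_cancel hc
    rw [h2]
    exact hu.2.trans_le (Nat.le_ceil τ)
  simp [pathAt, pathLeft, h1]

/-- With the real caches in configuration `R`, base station `j` may be the one that serves a request
for content `i` at the location `x`: it covers `x`, and it has the content whenever some base
station covering `x` has it. -/
def MayServe {N M K : ℕ} (C : Fin N → Set Plane) (R : Config N M K) (x : Plane) (i : Fin M)
    (j : Fin N) : Prop :=
  x ∈ C j ∧ ((∃ n, x ∈ C n ∧ i ∈ (R n).1) → i ∈ (R j).1)

/-- The update of the real caches from `R` to `R'` when base station `j` serves a request for content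
`i` and the virtual caches to be copied are `W`. If `j` lacks `i` and `i` is in the virtual cache of
`j`, then `i` is stored at `j`, in the place of some content `k ≠ i` in the real cache but not in the
virtual cache of `j`. Otherwise nothing changes. -/
def RealCacheStep {N M K : ℕ} (W : Config N M K) (i : Fin M) (j : Fin N)
    (R R' : Config N M K) : Prop :=
  ((i ∈ (R j).1 ∨ i ∉ (W j).1) → R' = R) ∧
  ((i ∉ (R j).1 ∧ i ∈ (W j).1) →
    (∃ k, k ≠ i ∧ k ∉ (W j).1 ∧ k ∈ (R j).1 ∧ (R' j).1 = insert i ((R j).1.erase k)) ∧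
    ∀ n, n ≠ j → R' n = R n)

/-- The real caches. `R n` is the configuration after the first `n` requests (`R 0` is arbitrary) and
`server n` is the base station that serves the request with index `n`, which arrives at time
`time n` and finds the caches in configuration `R n`. -/
structure IsRealCacheProcess {N M K : ℕ} {Ω : Type*} [MeasurableSpace Ω] (P : Measure Ω)
    (C : Fin N → Set Plane) (T : ℕ → ℝ) (V : ℕ → Ω → Config N M K)
    (time : ℕ → Ω → ℝ) (loc : ℕ → Ω → Plane) (content : ℕ → Ω → Fin M)
    (server : ℕ → Ω → Fin N) (R : ℕ → Ω → Config N M K) : Prop where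
  measurable_server : ∀ n, Measurable (server n)
  measurableSet_config : ∀ n B, MeasurableSet {ω | R n ω = B}
  serves : ∀ᵐ ω ∂P, ∀ n, MayServe C (R n ω) (loc n ω) (content n ω) (server n ω)
  step : ∀ᵐ ω ∂P, ∀ n,
    RealCacheStep (pathLeft (fun t => V t ω) (lastEpoch T (time n ω)))
      (content n ω) (server n ω) (R n ω) (R (n + 1) ω)

/-- The configuration `R(τ)` of the real caches at the continuous time `τ`. -/
def realCacheAt {N M K : ℕ} {Ω : Type*} (time : ℕ → Ω → ℝ) (R : ℕ → Ω → Config N M K)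
    (τ : ℝ) (ω : Ω) : Config N M K :=
  R (Set.ncard {n | time n ω ≤ τ}) ω

end

end CellularCaching

/-! The virtual caches form a random-scan Gibbs sampler. It is reversible with respect to `gibbs`
and reaches any configuration in N column updates, so Doeblin's contraction gives convergence in law
(`IsVirtualCacheProcess.tendsto_law`).

During one epoch the real caches chase a frozen target W. Contents of W are never evicted, and a
request for i falling in the area covered by j alone must be served by j, which puts i there if W
asks for it. Hence R = W as soon as each content has been requested in each such area
(`realCaches_eq_of_requests`). Poisson void probabilities bound the failure probability by a sum of
exponentials in the time since the epoch began, uniformly over epochs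
(`IsRealCacheProcess.abs_law_sub_le`).

So the law of R is close to the Gibbs law except in a bounded initial stretch of each late epoch.
Since the epoch lengths tend to infinity, these stretches have density zero and the time average
converges (`tendsto_integral_div_of_epochs`). -/

namespace CellularCaching

/-! ### Convergence of finite Markov chains. -/

section MarkovChain

open Matrix

variable {X : Type*} [Fintype X]

theorem sum_vecMul_of_row_sum {S : Matrix X X ℝ} (h1 : ∀ a, ∑ b, S a b = 1) (d : X → ℝ) :
    ∑ b, (d ᵥ* S) b = ∑ a, d a := by
  simp only [Matrix.vecMul, dotProduct]
  rw [Finset.sum_comm]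
  simp [← Finset.mul_sum, h1]

/-- Doeblin's contraction: a stochastic matrix with entries at least `δ` contracts the `ℓ¹`-norm of
the vectors of sum zero. -/
theorem sum_abs_vecMul_le {S : Matrix X X ℝ} {δ : ℝ} (hδ : ∀ a b, δ ≤ S a b)
    (h1 : ∀ a, ∑ b, S a b = 1) {d : X → ℝ} (hd : ∑ a, d a = 0) :
    ∑ b, |(d ᵥ* S) b| ≤ (1 - Fintype.card X * δ) * ∑ a, |d a| := by
  have key : ∀ b, |(d ᵥ* S) b| ≤ ∑ a, |d a| * (S a b - δ) := by
    intro b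
    -- Subtracting the constant δ is free because d sums to zero, and it leaves nonnegative weights
    -- of row sum 1 - |X|δ.
    have h : (d ᵥ* S) b = ∑ a, d a * (S a b - δ) := by
      simp [Matrix.vecMul, dotProduct, mul_sub, Finset.sum_sub_distrib, ← Finset.sum_mul, hd]
    rw [h]
    refine (Finset.abs_sum_le_sum_abs _ _).trans (Finset.sum_le_sum fun a _ => ?_)
    rw [abs_mul, abs_of_nonneg (sub_nonneg.mpr (hδ a b))]
  refine (Finset.sum_le_sum fun b _ => key b).trans (le_of_eq ?_)
  rw [Finset.sum_comm, Finset.mul_sum]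
  refine Finset.sum_congr rfl fun a _ => ?_
  rw [← Finset.mul_sum, Finset.sum_sub_distrib, h1]
  simp [mul_comm]

variable [DecidableEq X]

theorem pow_row_sum {Q : Matrix X X ℝ} (h1 : ∀ a, ∑ b, Q a b = 1) (n : ℕ) (a : X) :
    ∑ b, (Q ^ n) a b = 1 := by
  induction n generalizing a with
  | zero => simp [Matrix.one_apply]
  | succ n ih =>
    simp only [pow_succ', Matrix.mul_apply]
    rw [Finset.sum_comm]
    simp [← Finset.mul_sum, ih, h1]

/-- The laws of a finite Markov chain with a positive power of the transition matrix converge to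
the stationary distribution. -/
theorem tendsto_of_pow_pos {Q : Matrix X X ℝ} (h0 : ∀ a b, 0 ≤ Q a b)
    (h1 : ∀ a, ∑ b, Q a b = 1) {n : ℕ} (hn : ∀ a b, 0 < (Q ^ n) a b) {p : X → ℝ}
    (hp1 : ∑ a, p a = 1) (hp : p ᵥ* Q = p) {m : ℕ → X → ℝ} (hm1 : ∑ a, m 0 a = 1)
    (hm : ∀ t, m (t + 1) = m t ᵥ* Q) (b : X) :
    Tendsto (fun t => m t b) atTop (𝓝 (p b)) := by
  have : Nonempty X := ⟨b⟩
  have hsum : ∀ t, ∑ a, (m t - p) a = 0 := by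
    intro t
    have : ∑ a, m t a = 1 := by
      induction t with
      | zero => exact hm1
      | succ t ih => rw [hm, sum_vecMul_of_row_sum h1, ih]
    simp [Finset.sum_sub_distrib, this, hp1]
  have hpow : ∀ k t, m (t + k) - p = (m t - p) ᵥ* Q ^ k := by
    intro k t
    induction k with
    | zero => simp
    | succ k ih =>
      rw [pow_succ, ← Matrix.vecMul_vecMul, ← ih, ← add_assoc, hm, Matrix.sub_vecMul, hp]
  set e : ℕ → ℝ := fun t => ∑ a, |(m t - p) a| with he
  have e0 : ∀ t, 0 ≤ e t := fun t => Finset.sum_nonneg fun _ _ => abs_nonneg _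
  have hanti : Antitone e := by
    refine antitone_nat_of_succ_le fun t => ?_
    have := sum_abs_vecMul_le (δ := 0) h0 h1 (hsum t)
    have h2 := hpow 1 t
    rw [pow_one] at h2
    simp only [he, h2]
    simpa using this
  obtain ⟨x, hx⟩ := Finite.exists_min (fun x : X × X => (Q ^ n) x.1 x.2)
  set δ := (Q ^ n) x.1 x.2
  have hcontr : ∀ t, e (t + n) ≤ (1 - Fintype.card X * δ) * e t := by
    intro t
    simp only [he, hpow n t]
    exact sum_abs_vecMul_le (fun a b => hx (a, b)) (pow_row_sum h1 n) (hsum t)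
  have hbdd : BddBelow (range e) := ⟨0, by rintro _ ⟨t, rfl⟩; exact e0 t⟩
  have hlim := tendsto_atTop_ciInf hanti hbdd
  set l := ⨅ t, e t
  have hl0 : 0 ≤ l := le_ciInf e0
  -- The n-step contraction need not be iterated: monotonicity already gives a limit l, and passing
  -- to the limit in `hcontr` forces l = 0.
  have hl1 : l ≤ (1 - Fintype.card X * δ) * l :=
    le_of_tendsto_of_tendsto' ((tendsto_add_atTop_iff_nat n).mpr hlim) (hlim.const_mul _) hcontr
  have hc : 0 < Fintype.card X * δ := mul_pos (by exact_mod_cast Fintype.card_pos) (hn _ _)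
  have hl : l = 0 := by nlinarith
  rw [hl] at hlim
  rw [tendsto_iff_norm_sub_tendsto_zero]
  refine squeeze_zero (fun _ => norm_nonneg _) (fun t => ?_) hlim
  exact Finset.single_le_sum (f := fun a => |(m t - p) a|) (fun _ _ => abs_nonneg _)
    (Finset.mem_univ b)

end MarkovChain

/-! ### Reversibility and irreducibility of the Gibbs sampler. -/

section GibbsSampler

open Matrix

variable {N M K : ℕ} (C : Fin N → Set Plane) (rate : Fin M → ℝ) (β : ℝ)

theorem sum_exp_hitRate_pos [Nonempty (Config N M K)] :
    0 < ∑ B : Config N M K, Real.exp (β * hitRate C rate B) :=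
  Finset.sum_pos (fun _ _ => Real.exp_pos _) Finset.univ_nonempty

theorem gibbs_pos (B : Config N M K) : 0 < gibbs C rate β B := by
  have : Nonempty (Config N M K) := ⟨B⟩
  exact div_pos (Real.exp_pos _) (sum_exp_hitRate_pos C rate β)

theorem sum_gibbs [Nonempty (Config N M K)] : ∑ B : Config N M K, gibbs C rate β B = 1 := by
  simp only [gibbs]
  rw [← Finset.sum_div, div_self (sum_exp_hitRate_pos C rate β).ne']

open Classical in
/-- The weight under the Gibbs distribution of the configurations that agree with `B` except perhaps
in the `j`-th column. -/
noncomputable def gibbsFiber (B : Config N M K) (j : Fin N) : ℝ :=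
  ∑ A : Config N M K, if ∀ n, n ≠ j → A n = B n then gibbs C rate β A else 0

theorem gibbsFiber_pos (B : Config N M K) (j : Fin N) : 0 < gibbsFiber C rate β B j := by
  classical
  refine Finset.sum_pos' (fun A _ => ?_) ⟨B, Finset.mem_univ _, ?_⟩
  · split_ifs
    exacts [(gibbs_pos C rate β A).le, le_rfl]
  · simpa using gibbs_pos C rate β B

theorem gibbsFiber_congr {A B : Config N M K} {j : Fin N} (h : ∀ n, n ≠ j → A n = B n) :
    gibbsFiber C rate β A j = gibbsFiber C rate β B j := by
  classical
  refine Finset.sum_congr rfl fun D _ => ?_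
  have : (∀ n, n ≠ j → D n = A n) ↔ ∀ n, n ≠ j → D n = B n :=
    forall₂_congr fun n hn => by rw [h n hn]
  simp only [this]

open Classical in
theorem gibbsCond_eq (B : Config N M K) (j : Fin N) (A : Config N M K) :
    gibbsCond C rate β B j A =
      if ∀ n, n ≠ j → A n = B n then gibbs C rate β A / gibbsFiber C rate β B j else 0 := rfl

theorem gibbsCond_pos {A B : Config N M K} {j : Fin N} (h : ∀ n, n ≠ j → A n = B n) :
    0 < gibbsCond C rate β B j A := by
  rw [gibbsCond_eq, if_pos h]
  exact div_pos (gibbs_pos _ _ _ _) (gibbsFiber_pos _ _ _ _ _)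

theorem gibbsCond_nonneg (B : Config N M K) (j : Fin N) (A : Config N M K) :
    0 ≤ gibbsCond C rate β B j A := by
  by_cases h : ∀ n, n ≠ j → A n = B n
  · exact (gibbsCond_pos C rate β h).le
  · rw [gibbsCond_eq, if_neg h]

theorem sum_gibbsCond (B : Config N M K) (j : Fin N) :
    ∑ A, gibbsCond C rate β B j A = 1 := by
  classical
  simp only [gibbsCond_eq]
  rw [← div_self (gibbsFiber_pos C rate β B j).ne']
  nth_rw 2 [gibbsFiber]
  rw [Finset.sum_div]
  refine Finset.sum_congr rfl fun A _ => ?_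
  split_ifs <;> simp

/-- Detailed balance for a fixed column: A and B lie in the same fibre, so both sides are the
product of the two Gibbs weights over the same normalisation, or they lie in different fibres and
both sides vanish. -/
theorem gibbs_mul_gibbsCond_comm (A B : Config N M K) (j : Fin N) :
    gibbs C rate β A * gibbsCond C rate β A j B =
      gibbs C rate β B * gibbsCond C rate β B j A := by
  by_cases h : ∀ n, n ≠ j → A n = B n
  · have h' : ∀ n, n ≠ j → B n = A n := fun n hn => (h n hn).symm
    rw [gibbsCond_eq, gibbsCond_eq, if_pos h, if_pos h', gibbsFiber_congr C rate β h]
    ring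
  · have h' : ¬ ∀ n, n ≠ j → B n = A n := fun H => h fun n hn => (H n hn).symm
    rw [gibbsCond_eq, gibbsCond_eq, if_neg h, if_neg h']
    simp

/-- The transition matrix of the Gibbs sampler with random scan. -/
noncomputable def gibbsKernel : Matrix (Config N M K) (Config N M K) ℝ :=
  fun A B => ∑ j, (1 / (N : ℝ)) * gibbsCond C rate β A j B

theorem gibbsKernel_nonneg (A B : Config N M K) : 0 ≤ gibbsKernel C rate β A B :=
  Finset.sum_nonneg fun j _ => mul_nonneg (by positivity) (gibbsCond_nonneg C rate β A j B)

theorem gibbsKernel_row_sum (hN : N ≠ 0) (A : Config N M K) :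
    ∑ B, gibbsKernel C rate β A B = 1 := by
  simp only [gibbsKernel]
  rw [Finset.sum_comm]
  have : (N : ℝ) ≠ 0 := by exact_mod_cast hN
  simp [← Finset.mul_sum, sum_gibbsCond, this]

theorem gibbsKernel_pos {A B : Config N M K} {j : Fin N} (h : ∀ n, n ≠ j → B n = A n) :
    0 < gibbsKernel C rate β A B := by
  have hN : (0 : ℝ) < N := by exact_mod_cast j.pos
  refine Finset.sum_pos' (fun j _ => mul_nonneg (by positivity) (gibbsCond_nonneg C rate β A j B))
    ⟨j, Finset.mem_univ _, mul_pos (by positivity) (gibbsCond_pos C rate β h)⟩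

theorem gibbs_vecMul_gibbsKernel (hN : N ≠ 0) :
    (gibbs C rate β : Config N M K → ℝ) ᵥ* gibbsKernel C rate β = gibbs C rate β := by
  ext B
  have : ∀ A, gibbs C rate β A * gibbsKernel C rate β A B =
      gibbs C rate β B * gibbsKernel C rate β B A := by
    intro A
    simp only [gibbsKernel, Finset.mul_sum]
    refine Finset.sum_congr rfl fun j _ => ?_
    have := gibbs_mul_gibbsCond_comm C rate β A B j
    linear_combination (1 / (N : ℝ)) * this
  simp only [Matrix.vecMul, dotProduct, this]
  rw [← Finset.mul_sum, gibbsKernel_row_sum C rate β hN, mul_one]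

/-- The columns in s can be resampled one at a time, each directly to its value in B, and every such
move has positive probability. Taking s to be everything gives a positive power of the kernel. -/
theorem gibbsKernel_pow_pos (s : Finset (Fin N)) (A B : Config N M K)
    (h : ∀ n, n ∉ s → B n = A n) : 0 < (gibbsKernel C rate β ^ s.card) A B := by
  classical
  induction s using Finset.induction_on generalizing A with
  | empty =>
    have : B = A := funext fun n => h n (by simp)
    simp [this]
  | insert j s hj ih =>
    rw [Finset.card_insert_of_notMem hj, pow_succ', Matrix.mul_apply]
    have hnn : ∀ D, 0 ≤ (gibbsKernel C rate β ^ s.card) D B := by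
      intro D
      have : ∀ n (D B : Config N M K), 0 ≤ (gibbsKernel C rate β ^ n) D B := by
        intro n
        induction n with
        | zero =>
          intro D B
          rw [pow_zero, Matrix.one_apply]
          split_ifs <;> norm_num
        | succ n ihn =>
          intro D B
          rw [pow_succ, Matrix.mul_apply]
          exact Finset.sum_nonneg fun E _ => mul_nonneg (ihn _ _) (gibbsKernel_nonneg _ _ _ _ _)
      exact this _ _ _
    refine Finset.sum_pos' (fun D _ => mul_nonneg (gibbsKernel_nonneg C rate β A D) (hnn D))
      -- The intermediate state has column j already corrected, so it differs from B only on s.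
      ⟨Function.update A j (B j), Finset.mem_univ _, mul_pos ?_ (ih _ fun n hn => ?_)⟩
    · exact gibbsKernel_pos C rate β (j := j) fun n hn => Function.update_of_ne hn _ _
    · rcases eq_or_ne n j with rfl | hne
      · simp
      · rw [Function.update_of_ne hne]
        exact h n (by simp [hne, hn])

end GibbsSampler

/-! ### Law of the virtual caches. -/

section VirtualCaches

open Matrix

/-- Total probability, applied to the restriction of P to S; measurability is needed for the fibres
but not for S. -/
theorem measureReal_eq_sum_inter_fiber {Ω Y : Type*} [MeasurableSpace Ω] (P : Measure Ω)
    [IsFiniteMeasure P] [Fintype Y] {F : Ω → Y} (hF : ∀ y, MeasurableSet {ω | F ω = y})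
    (S : Set Ω) : P.real S = ∑ y, P.real ({ω | F ω = y} ∩ S) := by
  have h := sum_measureReal_preimage_singleton (μ := P.restrict S) (f := F) Finset.univ
    (fun y _ => hF y)
  simp only [Finset.coe_univ, preimage_univ] at h
  rw [measureReal_restrict_apply MeasurableSet.univ, univ_inter] at h
  rw [← h]
  exact Finset.sum_congr rfl fun y _ => measureReal_restrict_apply (hF y)

variable {N M K : ℕ} {Ω : Type*} [MeasurableSpace Ω] {P : Measure Ω} [IsProbabilityMeasure P]
  {C : Fin N → Set Plane} {rate : Fin M → ℝ} {β : ℝ}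
  {J : ℕ → Ω → Fin N} {V : ℕ → Ω → Config N M K}

/-- The process is specified through probabilities of complete histories; summing over the past and
over the next chosen station yields the one-step recursion for the marginal laws. -/
theorem IsVirtualCacheProcess.law_succ (hV : IsVirtualCacheProcess P C rate β J V) (t : ℕ) :
    (fun B => P.real {ω | V (t + 1) ω = B}) =
      (fun B => P.real {ω | V t ω = B}) ᵥ* gibbsKernel C rate β := by
  classical
  ext B
  let F : Ω → (Fin (t + 1) → Config N M K) × (Fin t → Fin N) :=
    fun ω => (fun u => V u ω, fun u => J (u + 1) ω)
  have hF : ∀ y, MeasurableSet {ω | F ω = y} := by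
    intro y
    have : {ω | F ω = y} = (⋂ u : Fin (t + 1), {ω | V u ω = y.1 u}) ∩
        ⋂ u : Fin t, {ω | J (u + 1) ω = y.2 u} := by
      ext ω
      simp [F, Prod.ext_iff, funext_iff]
    rw [this]
    exact (MeasurableSet.iInter fun u => hV.measurableSet_config _ _).inter
      (MeasurableSet.iInter fun u => hV.measurableSet_node _ _)
  have hstep : ∀ y jj, P.real ({ω | J (t + 1) ω = jj} ∩ ({ω | F ω = y} ∩ {ω | V (t + 1) ω = B})) =
      P.real {ω | F ω = y} * ((1 / (N : ℝ)) * gibbsCond C rate β (y.1 (Fin.last t)) jj B) := by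
    intro y jj
    -- The finite history is extended to sequences as `hV.step` requires, with default values chosen
    -- to be right at time t + 1. Station choices start at time 1, hence the shift in `j`; its value
    -- at 0 is never tested.
    let v : ℕ → Config N M K := fun u => if h : u < t + 1 then y.1 ⟨u, h⟩ else B
    let j : ℕ → Fin N := fun u => if h : u - 1 < t then y.2 ⟨u - 1, h⟩ else jj
    have hE : {ω | F ω = y} =
        {ω | (∀ u ≤ t, V u ω = v u) ∧ ∀ u, 1 ≤ u → u ≤ t → J u ω = j u} := by
      ext ω
      simp only [F, Prod.ext_iff, funext_iff, mem_ofPred_eq]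
      refine and_congr ⟨fun h u hu => ?_, fun h u => ?_⟩ ⟨fun h u hu hu' => ?_, fun h u => ?_⟩
      · have hu' : u < t + 1 := by omega
        simp only [v, dif_pos hu']
        exact h ⟨u, hu'⟩
      · have := h u (by omega)
        simpa only [v, dif_pos u.2] using this
      · have hu2 : u - 1 < t := by omega
        have := h ⟨u - 1, hu2⟩
        simp only [j, dif_pos hu2]
        rw [← this]
        congr 1
        simp only
        omega
      · have := h (u + 1) (by omega) (by omega)
        have hu2 : (u : ℕ) + 1 - 1 < t := by omega
        simpa only [j, dif_pos hu2, Nat.add_sub_cancel] using this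
    have hv : v (t + 1) = B := by simp [v]
    have hv' : v t = y.1 (Fin.last t) := by simp [v, Fin.last]
    have hj : j (t + 1) = jj := by simp [j]
    have hE' : {ω | J (t + 1) ω = jj} ∩ ({ω | F ω = y} ∩ {ω | V (t + 1) ω = B}) =
        {ω | (∀ u ≤ t + 1, V u ω = v u) ∧ ∀ u, 1 ≤ u → u ≤ t + 1 → J u ω = j u} := by
      rw [hE]
      ext ω
      simp only [mem_inter_iff, mem_ofPred_eq]
      constructor
      · rintro ⟨h1, ⟨h2, h3⟩, h4⟩
        refine ⟨fun u hu => ?_, fun u hu hu' => ?_⟩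
        · rcases Nat.lt_or_ge t u with h | h
          · obtain rfl : u = t + 1 := by omega
            rw [h4, hv]
          · exact h2 u h
        · rcases Nat.lt_or_ge t u with h | h
          · obtain rfl : u = t + 1 := by omega
            rw [h1, hj]
          · exact h3 u hu h
      · rintro ⟨h1, h2⟩
        exact ⟨(h2 _ (by omega) le_rfl).trans hj,
          ⟨fun u hu => h1 u (by omega), fun u hu hu' => h2 u hu (by omega)⟩,
          (h1 _ le_rfl).trans hv⟩
    rw [hE', hE, hV.step t j v, hv, hv', hj]
  have hlast : ∀ A y, P.real ({ω | F ω = y} ∩ {ω | V t ω = A}) =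
      if y.1 (Fin.last t) = A then P.real {ω | F ω = y} else 0 := by
    intro A y
    have hVt : ∀ ω, F ω = y → V t ω = y.1 (Fin.last t) := by
      rintro ω rfl
      simp [F]
    split_ifs with h
    · congr 1
      ext ω
      simp only [mem_inter_iff, mem_ofPred_eq, and_iff_left_iff_imp]
      exact fun hω => (hVt ω hω).trans h
    · convert measureReal_empty (μ := P)
      ext ω
      simp only [mem_inter_iff, mem_ofPred_eq, mem_empty_iff_false, iff_false, not_and]
      exact fun hω hA => h ((hVt ω hω).symm.trans hA)
  rw [measureReal_eq_sum_inter_fiber P hF]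
  simp only [Matrix.vecMul, dotProduct]
  calc ∑ y, P.real ({ω | F ω = y} ∩ {ω | V (t + 1) ω = B})
      = ∑ y, P.real {ω | F ω = y} * gibbsKernel C rate β (y.1 (Fin.last t)) B := by
        refine Finset.sum_congr rfl fun y _ => ?_
        rw [measureReal_eq_sum_inter_fiber P (hV.measurableSet_node (t + 1))]
        simp only [hstep, gibbsKernel, Finset.mul_sum]
    _ = ∑ y, ∑ A, P.real ({ω | F ω = y} ∩ {ω | V t ω = A}) * gibbsKernel C rate β A B := by
        refine Finset.sum_congr rfl fun y _ => ?_
        simp [hlast]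
    _ = ∑ A, P.real {ω | V t ω = A} * gibbsKernel C rate β A B := by
        rw [Finset.sum_comm]
        refine Finset.sum_congr rfl fun A _ => ?_
        rw [← Finset.sum_mul, ← measureReal_eq_sum_inter_fiber P hF]

theorem IsVirtualCacheProcess.tendsto_law (hV : IsVirtualCacheProcess P C rate β J V)
    (B : Config N M K) :
    Tendsto (fun t => P.real {ω | V t ω = B}) atTop (𝓝 (gibbs C rate β B)) := by
  classical
  have : Nonempty (Config N M K) := ⟨B⟩
  obtain ⟨ω⟩ := nonempty_of_isProbabilityMeasure P
  have hN : N ≠ 0 := (J 0 ω).pos.ne'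
  refine tendsto_of_pow_pos (gibbsKernel_nonneg C rate β) (gibbsKernel_row_sum C rate β hN)
    (n := (Finset.univ : Finset (Fin N)).card)
    (fun A B => gibbsKernel_pow_pos C rate β _ A B (by simp)) (sum_gibbs C rate β)
    (gibbs_vecMul_gibbsKernel C rate β hN) (m := fun t B => P.real {ω | V t ω = B}) ?_
    hV.law_succ B
  have := measureReal_eq_sum_inter_fiber P (hV.measurableSet_config 0) univ
  simpa using this.symm

end VirtualCaches

end CellularCaching

namespace CellularCaching

/-! ### Averaging over epochs of growing length. -/

section Epochs

variable {T : ℕ → ℝ}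

theorem epoch_succ (T : ℕ → ℝ) (l : ℕ) : epoch T (l + 1) = epoch T l + T l :=
  Finset.sum_range_succ _ _

theorem epoch_zero (T : ℕ → ℝ) : epoch T 0 = 0 := Finset.sum_range_zero _

theorem epoch_strictMono (hT : ∀ k, 0 < T k) : StrictMono (epoch T) :=
  strictMono_nat_of_lt_succ fun l => by linarith [epoch_succ T l, hT l]

theorem epoch_nonneg (hT : ∀ k, 0 < T k) (l : ℕ) : 0 ≤ epoch T l :=
  Finset.sum_nonneg fun k _ => (hT k).le

theorem tendsto_epoch_atTop (hT : ∀ k, 0 < T k) (hlim : Tendsto T atTop atTop) :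
    Tendsto (epoch T) atTop atTop := by
  refine (tendsto_add_atTop_iff_nat 1).mp (tendsto_atTop_mono (fun l => ?_) hlim)
  linarith [epoch_succ T l, epoch_nonneg hT l]

theorem lastEpoch_eq (hT : ∀ k, 0 < T k) {l : ℕ} {τ : ℝ} (h : epoch T l ≤ τ)
    (h' : τ < epoch T (l + 1)) : lastEpoch T τ = epoch T l := by
  have : {k : ℕ | epoch T k ≤ τ} = Set.Iic l := by
    ext k
    simp only [mem_ofPred_eq, mem_Iic]
    refine ⟨fun hk => ?_, fun hk => ((epoch_strictMono hT).monotone hk).trans h⟩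
    exact Nat.lt_succ_iff.mp ((epoch_strictMono hT).lt_iff_lt.mp (hk.trans_lt h'))
  rw [lastEpoch, this, csSup_Iic]

theorem exists_epoch_le_lt (hT : ∀ k, 0 < T k) (hlim : Tendsto T atTop atTop) {τ : ℝ}
    (hτ : 0 ≤ τ) : ∃ l, epoch T l ≤ τ ∧ τ < epoch T (l + 1) := by
  classical
  have hex : ∃ l, τ < epoch T l := ((tendsto_epoch_atTop hT hlim).eventually_gt_atTop τ).exists
  have h1 := Nat.find_spec hex
  have h0 : Nat.find hex ≠ 0 := by
    intro h
    rw [h, epoch_zero] at h1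
    exact absurd h1 (not_lt.mpr hτ)
  obtain ⟨l, hl⟩ := Nat.exists_eq_succ_of_ne_zero h0
  refine ⟨l, not_lt.mp (Nat.find_min hex (by omega)), ?_⟩
  rw [hl] at h1
  exact h1

/-- A bounded function that gets small after a fixed delay in all late epochs vanishes in time
average, provided that the lengths of the epochs tend to infinity. -/
theorem tendsto_integral_div_of_epochs (hT : ∀ k, 0 < T k) (hlim : Tendsto T atTop atTop)
    {f : ℝ → ℝ} (hf : ∀ a b, IntervalIntegrable f volume a b)
    (hf0 : ∀ τ, 0 ≤ f τ) (hf1 : ∀ τ, f τ ≤ 1)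
    (hsmall : ∀ ε > 0, ∃ a : ℝ, 0 ≤ a ∧ ∃ L, ∀ l ≥ L, ∀ τ, epoch T l + a ≤ τ →
      τ < epoch T (l + 1) → f τ ≤ ε) :
    Tendsto (fun t => (∫ τ in (0 : ℝ)..t, f τ) / t) atTop (𝓝 0) := by
  have hle : ∀ {x y c : ℝ}, x ≤ y → (∀ τ ∈ Ioo x y, f τ ≤ c) →
      ∫ τ in x..y, f τ ≤ c * (y - x) := by
    intro x y c hxy h
    have := intervalIntegral.integral_mono_on_of_le_Ioo hxy (hf x y)
      (intervalIntegrable_const (c := c)) h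
    simpa [mul_comm] using this
  rw [Metric.tendsto_atTop]
  intro ε hε
  obtain ⟨a, ha, L₀, hL₀⟩ := hsmall (ε / 4) (by positivity)
  -- Past L₁ the initial stretch a is at most a fraction ε/4 of its epoch; with the bound ε/4 on the
  -- remainder, each complete epoch contributes at most ε/2 times its length.
  obtain ⟨L₁, hL₁⟩ := eventually_atTop.mp (hlim.eventually_ge_atTop (a / (ε / 4)))
  obtain ⟨L, hL0, hL1⟩ : ∃ L, L₀ ≤ L ∧ L₁ ≤ L := ⟨_, le_max_left _ _, le_max_right _ _⟩
  have hpart : ∀ l ≥ L, ∀ t, epoch T l ≤ t → t ≤ epoch T (l + 1) →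
      ∫ τ in epoch T l..t, f τ ≤ a + ε / 4 * (t - epoch T l) := by
    intro l hl t h h'
    rcases le_total t (epoch T l + a) with hta | hta
    · have := hle h (fun τ _ => hf1 τ)
      have : 0 ≤ ε / 4 * (t - epoch T l) := mul_nonneg (by positivity) (by linarith)
      linarith
    · rw [← intervalIntegral.integral_add_adjacent_intervals (hf _ (epoch T l + a)) (hf _ _)]
      have h1 := hle (x := epoch T l) (y := epoch T l + a) (by linarith) (fun τ _ => hf1 τ)
      have h2 := hle hta (c := ε / 4) fun τ hτ =>
        hL₀ l (hL0.trans hl) τ hτ.1.le (hτ.2.trans_le h')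
      nlinarith
  have hfull : ∀ l ≥ L, ∫ τ in (0 : ℝ)..epoch T l, f τ ≤
      epoch T L + ε / 2 * (epoch T l - epoch T L) := by
    intro l hl
    induction l, hl using Nat.le_induction with
    | base => simpa using hle (epoch_nonneg hT L) (fun τ _ => hf1 τ)
    | succ l hl ih =>
      rw [← intervalIntegral.integral_add_adjacent_intervals (hf _ (epoch T l)) (hf _ _)]
      have h1 := hpart l hl (epoch T (l + 1)) (by linarith [epoch_succ T l, hT l]) le_rfl
      have h2 : a ≤ ε / 4 * T l := by
        have := hL₁ l (hL1.trans hl)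
        rwa [div_le_iff₀' (by positivity)] at this
      rw [epoch_succ] at h1 ⊢
      nlinarith
  -- The early epochs and the initial stretch of the current, incomplete one cost at most `epoch T L
  -- + a`, which is below εt/4 from here on; the added 1 gives strictness and t > 0.
  refine ⟨max (epoch T L) (4 * (epoch T L + a + 1) / ε), fun t ht => ?_⟩
  have ht1 : epoch T L ≤ t := (le_max_left _ _).trans ht
  have ht2 : 4 * (epoch T L + a + 1) ≤ t * ε := (div_le_iff₀ hε).mp ((le_max_right _ _).trans ht)
  have hS := epoch_nonneg hT L
  have htpos : 0 < t := by
    by_contra h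
    nlinarith
  obtain ⟨l, h, h'⟩ := exists_epoch_le_lt hT hlim htpos.le
  have hl : L ≤ l :=
    Nat.lt_succ_iff.mp ((epoch_strictMono hT).lt_iff_lt.mp (ht1.trans_lt h'))
  have hmono := (epoch_strictMono hT).monotone hl
  have hint : ∫ τ in (0 : ℝ)..t, f τ ≤ epoch T L + a + ε / 2 * t := by
    rw [← intervalIntegral.integral_add_adjacent_intervals (hf _ (epoch T l)) (hf _ _)]
    have h1 := hfull l hl
    have h2 := hpart l hl t h h'.le
    nlinarith
  have h0 : 0 ≤ (∫ τ in (0 : ℝ)..t, f τ) / t :=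
    div_nonneg (intervalIntegral.integral_nonneg htpos.le fun τ _ => hf0 τ) htpos.le
  rw [Real.dist_eq, sub_zero, abs_of_nonneg h0, div_lt_iff₀ htpos]
  nlinarith

end Epochs

/-! ### Void probabilities of the request process. -/

section Requests

variable {N M : ℕ} {Ω : Type*} {C : Fin N → Set Plane} {rate : Fin M → ℝ}
  {time : ℕ → Ω → ℝ} {loc : ℕ → Ω → Plane} {content : ℕ → Ω → Fin M}

theorem requestCount_eq_zero_iff {i : Fin M} {A : Set (ℝ × Plane)} {ω : Ω} :
    requestCount time loc content i A ω = 0 ↔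
      ∀ n, content n ω = i → (time n ω, loc n ω) ∉ A := by
  simp [requestCount, Set.encard_eq_zero, Set.eq_empty_iff_forall_notMem]

theorem requestIntensity_prod {r : ℝ} {a b : ℝ} (ha : 0 ≤ a) {D : Set Plane}
    (hD : MeasurableSet D) (hDC : D ⊆ ⋃ j, C j) :
    requestIntensity C r (Ioc a b ×ˢ D) =
      ENNReal.ofReal r * (ENNReal.ofReal (b - a) * volume D) := by
  have h : Ioc a b ∩ Ici 0 = Ioc a b :=
    inter_eq_left.mpr fun x hx => ha.trans hx.1.le
  rw [requestIntensity, Measure.smul_apply, Measure.prod_prod, Measure.restrict_apply hD,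
    Measure.restrict_apply measurableSet_Ioc, h, inter_eq_left.mpr hDC, Real.volume_Ioc,
    smul_eq_mul]

theorem IsPoissonRequestProcess.measureReal_no_request
    [MeasurableSpace Ω] {P : Measure Ω} (hreq : IsPoissonRequestProcess P C rate time loc content) (i : Fin M) (hr : 0 ≤ rate i)
    {D : Set Plane} (hD : MeasurableSet D) (hDC : D ⊆ ⋃ j, C j) (hDf : volume D ≠ ⊤) {a b : ℝ}
    (ha : 0 ≤ a) (hab : a ≤ b) :
    P.real {ω | ∀ n, content n ω = i → (time n ω, loc n ω) ∉ Ioc a b ×ˢ D} =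
      Real.exp (-(rate i * (volume D).toReal * (b - a))) := by
  have hI := requestIntensity_prod (C := C) (r := rate i) (b := b) ha hD hDC
  have hfin : requestIntensity C (rate i) (Ioc a b ×ˢ D) ≠ ⊤ := by
    rw [hI]
    finiteness
  have h := hreq.poisson i _ (measurableSet_Ioc.prod hD) hfin 0
  simp only [Nat.cast_zero, requestCount_eq_zero_iff] at h
  rw [Measure.real, h]
  have hval : ((requestIntensity C (rate i) (Ioc a b ×ˢ D)).toNNReal : ℝ) =
      rate i * (volume D).toReal * (b - a) := by
    rw [ENNReal.coe_toNNReal_eq_toReal, hI, ENNReal.toReal_mul, ENNReal.toReal_mul,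
      ENNReal.toReal_ofReal hr, ENNReal.toReal_ofReal (sub_nonneg.mpr hab)]
    ring
  have := poissonMeasure_real_singleton (requestIntensity C (rate i) (Ioc a b ×ˢ D)).toNNReal 0
  rw [Measure.real] at this
  rw [this, hval]
  simp

end Requests

end CellularCaching

namespace CellularCaching

/-! ### Real caches catching up with the virtual ones. -/

section RealCaches

variable {N M K : ℕ}

/-- Only contents outside the target W are evicted, so progress towards W is never undone. -/
theorem RealCacheStep.mem_of_mem {W R R' : Config N M K} {i : Fin M} {j : Fin N}
    (h : RealCacheStep W i j R R') {i' : Fin M} {j' : Fin N} (hR : i' ∈ (R j').1)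
    (hW : i' ∈ (W j').1) : i' ∈ (R' j').1 := by
  by_cases hc : i ∈ (R j).1 ∨ i ∉ (W j).1
  · rwa [h.1 hc]
  · push Not at hc
    obtain ⟨⟨k, -, hkW, -, hR'⟩, hne⟩ := h.2 hc
    rcases eq_or_ne j' j with rfl | hj
    · rw [hR', Finset.mem_insert, Finset.mem_erase]
      exact Or.inr ⟨fun hk => hkW (hk ▸ hW), hR⟩
    · rwa [hne j' hj]

theorem RealCacheStep.mem_of_served {W R R' : Config N M K} {i : Fin M} {j : Fin N}
    (h : RealCacheStep W i j R R') (hW : i ∈ (W j).1) : i ∈ (R' j).1 := by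
  by_cases hc : i ∈ (R j).1
  · exact h.mem_of_mem hc hW
  · obtain ⟨⟨k, -, -, -, hR'⟩, -⟩ := h.2 ⟨hc, hW⟩
    simp [hR']

/-- The part of the cell of `j` that is covered by no other base station. -/
def ownCell (C : Fin N → Set Plane) (j : Fin N) : Set Plane :=
  C j ∩ (⋃ k ∈ {k : Fin N | k ≠ j}, C k)ᶜ

theorem MayServe.eq_of_mem_ownCell {C : Fin N → Set Plane} {R : Config N M K} {x : Plane}
    {i : Fin M} {j k : Fin N} (h : MayServe C R x i k) (hx : x ∈ ownCell C j) : k = j := by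
  by_contra hk
  exact hx.2 (mem_biUnion (show k ∈ {k : Fin N | k ≠ j} from hk) h.1)

/-- Once every content has been requested in the own cell of every base station, the real caches
agree with the virtual caches that are being copied. -/
theorem realCaches_eq_of_requests {C : Fin N → Set Plane} {W : Config N M K} {time : ℕ → ℝ}
    {loc : ℕ → Plane} {content : ℕ → Fin M} {server : ℕ → Fin N} {R : ℕ → Config N M K}
    {a τ : ℝ} {m : ℕ} (htime : Monotone time) (hm : ∀ n, time n ≤ τ ↔ n < m)
    (hserve : ∀ n, MayServe C (R n) (loc n) (content n) (server n))
    (hstep : ∀ n, a < time n → time n ≤ τ →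
      RealCacheStep W (content n) (server n) (R n) (R (n + 1)))
    (hreq : ∀ i j, ∃ n, content n = i ∧ (time n, loc n) ∈ Ioc a τ ×ˢ ownCell C j) :
    R m = W := by
  -- Since all caches hold exactly K contents, it suffices that every content of W has arrived: no
  -- obsolete content can then remain.
  refine funext fun j => Subtype.ext (Finset.eq_of_subset_of_card_le (fun i hi => ?_) ?_).symm
  · obtain ⟨n, hn, ⟨han, hnτ⟩, hloc⟩ := hreq i j
    have hs : server n = j := (hserve n).eq_of_mem_ownCell hloc
    have h0 := hstep n han hnτ
    rw [hn, hs] at h0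
    have hstay : ∀ k, n + 1 ≤ k → k ≤ m → i ∈ (R k j).1 := by
      intro k hk
      induction k, hk using Nat.le_induction with
      | base => exact fun _ => h0.mem_of_served hi
      | succ k hk ih =>
        intro hkm
        exact (hstep k (han.trans_le (htime (by omega))) ((hm k).mpr hkm)).mem_of_mem
          (ih (by omega)) hi
    exact hstay m ((hm n).mp hnτ) le_rfl
  · rw [(R m j).2, (W j).2]

theorem exists_le_iff_lt {time : ℕ → ℝ} (hmono : Monotone time)
    (hlim : Tendsto time atTop atTop) (τ : ℝ) : ∃ m, ∀ n, time n ≤ τ ↔ n < m := by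
  classical
  have hex : ∃ n, τ < time n := (hlim.eventually_gt_atTop τ).exists
  refine ⟨Nat.find hex, fun n => ⟨fun h => ?_, fun h => not_lt.mp (Nat.find_min hex h)⟩⟩
  by_contra hn
  exact absurd (h.trans_lt (Nat.find_spec hex)) (not_lt.mpr (hmono (not_lt.mp hn)))

theorem ncard_setOf_le {time : ℕ → ℝ} {τ : ℝ} {m : ℕ} (hm : ∀ n, time n ≤ τ ↔ n < m) :
    Set.ncard {n | time n ≤ τ} = m := by
  have : {n | time n ≤ τ} = ((Finset.range m : Finset ℕ) : Set ℕ) := by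
    ext n
    simp [hm]
  rw [this, Set.ncard_coe_finset, Finset.card_range]

variable {Ω : Type*} [MeasurableSpace Ω] {P : Measure Ω} [IsProbabilityMeasure P]
  {C : Fin N → Set Plane} {rate : Fin M → ℝ} {T : ℕ → ℝ} {V : ℕ → Ω → Config N M K}
  {time : ℕ → Ω → ℝ} {loc : ℕ → Ω → Plane} {content : ℕ → Ω → Fin M}
  {server : ℕ → Ω → Fin N} {R : ℕ → Ω → Config N M K}

/-- Almost surely the event is a section of a measurable subset E of time × Ω, obtained by splitting
according to the number m of requests so far; measurability in τ is then that of measures of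
sections. -/
theorem measurable_measureReal_realCacheAt
    (hreq : IsPoissonRequestProcess P C rate time loc content)
    (hR : ∀ n B, MeasurableSet {ω | R n ω = B}) (B : Config N M K) :
    Measurable fun τ => P.real {ω | realCacheAt time R τ ω = B} := by
  let E : Set (ℝ × Ω) := ⋃ m : ℕ, (⋂ k ∈ Iio m, {p | time k p.2 ≤ p.1}) ∩
    ({p | p.1 < time m p.2} ∩ Prod.snd ⁻¹' {ω | R m ω = B})
  have hE : MeasurableSet E := by
    refine MeasurableSet.iUnion fun m => (MeasurableSet.biInter (to_countable _) fun k _ => ?_).inter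
      ((measurableSet_lt measurable_fst ((hreq.measurable_time m).comp measurable_snd)).inter
        (measurable_snd (hR m B)))
    exact measurableSet_le ((hreq.measurable_time k).comp measurable_snd) measurable_fst
  have h : (fun τ => P.real {ω | realCacheAt time R τ ω = B}) =
      fun τ => (P (Prod.mk τ ⁻¹' E)).toReal := by
    ext τ
    refine measureReal_congr ?_
    filter_upwards [hreq.ordered] with ω hω
    obtain ⟨m, hm⟩ := exists_le_iff_lt hω.1.monotone hω.2 τ
    refine propext ?_
    change R (Set.ncard {n | time n ω ≤ τ}) ω = B ↔ (τ, ω) ∈ E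
    rw [ncard_setOf_le hm]
    simp only [E, mem_iUnion, mem_inter_iff, mem_iInter, mem_ofPred_eq, mem_preimage, mem_Iio, hm,
      ← @not_le _ _ _ τ]
    constructor
    · exact fun h => ⟨m, fun k hk => hk, lt_irrefl m, h⟩
    · rintro ⟨m', h1, h2, h3⟩
      obtain rfl : m' = m := by
        rcases Nat.lt_trichotomy m' m with h | h | h
        exacts [absurd h h2, h, absurd (h1 m h) (lt_irrefl m)]
      exact h3
  rw [h]
  exact (measurable_measure_prodMk_left hE).ennreal_toReal

theorem ownCell_subset (C : Fin N → Set Plane) (j : Fin N) : ownCell C j ⊆ C j := inter_subset_left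

theorem measurableSet_ownCell (hC : ∀ j, MeasurableSet (C j)) (j : Fin N) :
    MeasurableSet (ownCell C j) :=
  (hC j).inter (MeasurableSet.biUnion (to_countable _) fun k _ => hC k).compl

/-- The coupling inequality. It uses only monotonicity and subadditivity, so no measurability of the
events is required. -/
theorem abs_measureReal_sub_le_of_ae {X : Type*} {f g : Ω → X} {D : Set Ω}
    (h : ∀ᵐ ω ∂P, ω ∉ D → f ω = g ω) (x : X) :
    |P.real {ω | f ω = x} - P.real {ω | g ω = x}| ≤ P.real D := by
  have key : ∀ {f g : Ω → X}, (∀ᵐ ω ∂P, ω ∉ D → f ω = g ω) →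
      P.real {ω | f ω = x} ≤ P.real {ω | g ω = x} + P.real D := by
    intro f g h
    refine le_trans ?_ (measureReal_union_le _ _)
    refine ENNReal.toReal_mono (measure_ne_top _ _) (measure_mono_ae ?_)
    filter_upwards [h] with ω hω hf
    by_cases hD : ω ∈ D
    · exact Or.inr hD
    · exact Or.inl ((hω hD).symm.trans hf)
  rw [abs_sub_le_iff]
  constructor
  · linarith [key h]
  · linarith [key (h.mono fun ω hω hD => (hω hD).symm)]

/-- At the time `τ` of the `l`-th epoch, the real caches agree with the virtual caches that are being
copied up to an event whose probability decays exponentially in the time elapsed since the start of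
the epoch. -/
theorem IsRealCacheProcess.abs_law_sub_le (hC : ∀ j, MeasurableSet (C j))
    (hCf : ∀ j, volume (C j) ≠ ⊤) (hrate : ∀ i, 0 < rate i) (hT : ∀ k, 0 < T k)
    (hreq : IsPoissonRequestProcess P C rate time loc content)
    (hR : IsRealCacheProcess P C T V time loc content server R) (B : Config N M K) {l : ℕ} {τ : ℝ}
    (hl : epoch T l ≤ τ) (hl' : τ < epoch T (l + 1)) :
    |P.real {ω | realCacheAt time R τ ω = B} - P.real {ω | V (⌈epoch T l⌉₊ - 1) ω = B}| ≤
      ∑ p : Fin M × Fin N,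
        Real.exp (-(rate p.1 * (volume (ownCell C p.2)).toReal * (τ - epoch T l))) := by
  let D : Fin M × Fin N → Set Ω := fun p =>
    {ω | ∀ n, content n ω = p.1 → (time n ω, loc n ω) ∉ Ioc (epoch T l) τ ×ˢ ownCell C p.2}
  have hD : ∀ p, P.real (D p) =
      Real.exp (-(rate p.1 * (volume (ownCell C p.2)).toReal * (τ - epoch T l))) := fun p =>
    hreq.measureReal_no_request p.1 (hrate _).le (measurableSet_ownCell hC _)
      ((ownCell_subset C _).trans (subset_iUnion C _))
      (measure_ne_top_of_subset (ownCell_subset C _) (hCf _)) (epoch_nonneg hT l) hl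
  refine (abs_measureReal_sub_le_of_ae (D := ⋃ p, D p) ?_ B).trans
    ((measureReal_iUnion_fintype_le D).trans (Finset.sum_le_sum fun p _ => (hD p).le))
  filter_upwards [hreq.ordered, hR.serves, hR.step] with ω hord hserve hstep hω
  obtain ⟨m, hm⟩ := exists_le_iff_lt hord.1.monotone hord.2 τ
  rw [realCacheAt, ncard_setOf_le hm]
  refine realCaches_eq_of_requests (R := fun n => R n ω) hord.1.monotone hm hserve
    (a := epoch T l) (fun n h1 h2 => ?_) fun i j => ?_
  -- Throughout the epoch `lastEpoch` equals its starting time, so all these updates copy the same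
  -- virtual configuration.
  · have := hstep n
    rwa [lastEpoch_eq hT h1.le (h2.trans_lt hl')] at this
  · have : ω ∉ D (i, j) := fun h => hω (mem_iUnion.mpr ⟨_, h⟩)
    simpa only [D, mem_ofPred_eq, not_forall, not_not, exists_prop] using this

end RealCaches

end CellularCaching

theorem theorem2 {N M K : ℕ} (hKM : K < M)
    -- the cells: measurable, of finite area, each with a positive area covered only by itself
    (C : Fin N → Set CellularCaching.Plane)
    (hC_meas : ∀ j, MeasurableSet (C j))
    (hC_fin : ∀ j, volume (C j) ≠ ⊤)
    (hC_own : ∀ i, 0 < volume (C i ∩ (⋃ j ∈ {j : Fin N | j ≠ i}, C j)ᶜ))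
    -- the request intensities of the contents and the inverse temperature
    (rate : Fin M → ℝ) (hrate : ∀ i, 0 < rate i) (β : ℝ)
    -- the durations between the epochs of the real cache updates
    (T : ℕ → ℝ) (hT_pos : ∀ k, 0 < T k) (hT_mono : Monotone T) (hT_lim : Tendsto T atTop atTop)
    {Ω : Type*} [MeasurableSpace Ω] (P : Measure Ω) [IsProbabilityMeasure P]
    -- the virtual caches
    (J : ℕ → Ω → Fin N) (V : ℕ → Ω → CellularCaching.Config N M K)
    (hV : CellularCaching.IsVirtualCacheProcess P C rate β J V)
    -- the requests
    (time : ℕ → Ω → ℝ) (loc : ℕ → Ω → CellularCaching.Plane) (content : ℕ → Ω → Fin M)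
    (hreq : CellularCaching.IsPoissonRequestProcess P C rate time loc content)
    -- the real caches
    (server : ℕ → Ω → Fin N) (R : ℕ → Ω → CellularCaching.Config N M K)
    (hR : CellularCaching.IsRealCacheProcess P C T V time loc content server R)
    (B : CellularCaching.Config N M K) :
    (∀ t : ℝ, 0 ≤ t → IntervalIntegrable
      (fun τ => P.real {ω | CellularCaching.realCacheAt time R τ ω = B}) volume 0 t) ∧
    Tendsto
      (fun t : ℝ =>
        (∫ τ in (0 : ℝ)..t, P.real {ω | CellularCaching.realCacheAt time R τ ω = B}) / t)
      atTop
      (𝓝 (Real.exp (β * CellularCaching.hitRate C rate B) /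
        ∑ B' : CellularCaching.Config N M K,
          Real.exp (β * CellularCaching.hitRate C rate B'))) := by
  open CellularCaching in
  change _ ∧ Tendsto _ _ (𝓝 (gibbs C rate β B))
  set g : ℝ → ℝ := fun τ => P.real {ω | realCacheAt time R τ ω = B} with hg
  set q := gibbs C rate β B with hq
  have hgm : Measurable g := measurable_measureReal_realCacheAt hreq hR.measurableSet_config B
  have hint : ∀ {f : ℝ → ℝ}, Measurable f → (∀ τ, |f τ| ≤ 1) →
      ∀ a b, IntervalIntegrable f volume a b := fun hf hf1 a b =>
    (intervalIntegrable_const (c := (1 : ℝ))).mono_fun hf.aestronglyMeasurable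
      (Eventually.of_forall fun τ => by simpa using hf1 τ)
  have hg0 : ∀ τ, 0 ≤ g τ := fun τ => measureReal_nonneg
  have hg1 : ∀ τ, g τ ≤ 1 := fun τ => measureReal_le_one
  have hgi := hint hgm fun τ => by rw [abs_of_nonneg (hg0 τ)]; exact hg1 τ
  have hlaw := hV.tendsto_law B
  have hq0 : 0 ≤ q := (gibbs_pos C rate β B).le
  have hq1 : q ≤ 1 := le_of_tendsto' hlaw fun t => measureReal_le_one
  have hf1 : ∀ τ, |g τ - q| ≤ 1 := fun τ =>
    abs_sub_le_iff.mpr ⟨by linarith [hg1 τ], by linarith [hg0 τ]⟩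
  have hfm : Measurable fun τ => |g τ - q| := (hgm.sub_const q).abs
  -- It remains to show that the nonnegative function |g - q| vanishes in time average, which
  -- dominates the error of the average of g.
  refine ⟨fun t _ => hgi 0 t, ?_⟩
  have hmean := tendsto_integral_div_of_epochs hT_pos hT_lim (f := fun τ => |g τ - q|)
    (hint hfm fun τ => by rw [abs_abs]; exact hf1 τ) (fun τ => abs_nonneg _) hf1 ?_
  · rw [tendsto_iff_norm_sub_tendsto_zero]
    refine squeeze_zero' (Eventually.of_forall fun _ => norm_nonneg _) ?_ hmean
    filter_upwards [eventually_gt_atTop 0] with t ht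
    have h1 : (∫ τ in (0 : ℝ)..t, g τ) / t - q = (∫ τ in (0 : ℝ)..t, (g τ - q)) / t := by
      rw [intervalIntegral.integral_sub (hgi 0 t) intervalIntegrable_const,
        intervalIntegral.integral_const]
      simp only [sub_zero, smul_eq_mul]
      field_simp
    rw [h1, norm_div, Real.norm_of_nonneg ht.le]
    exact div_le_div_of_nonneg_right
      (intervalIntegral.norm_integral_le_integral_norm ht.le) ht.le
  · intro ε hε
    have hdecay : Tendsto (fun x : ℝ => ∑ p : Fin M × Fin N,
        Real.exp (-(rate p.1 * (volume (ownCell C p.2)).toReal * x))) atTop (𝓝 0) := by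
      rw [← Finset.sum_const_zero (s := (Finset.univ : Finset (Fin M × Fin N)))]
      -- Each decay rate is positive because every cell has positive area of its own, and finite
      -- area keeps `toReal` from collapsing it to 0.
      refine tendsto_finsetSum _ fun p _ => Real.tendsto_exp_neg_atTop_nhds_zero.comp
        (tendsto_id.const_mul_atTop (mul_pos (hrate p.1) (ENNReal.toReal_pos (hC_own p.2).ne' ?_)))
      exact measure_ne_top_of_subset (ownCell_subset C _) (hC_fin _)
    obtain ⟨a, ha⟩ := eventually_atTop.mp (hdecay.eventually_le_const (half_pos hε))
    have hidx : Tendsto (fun l => ⌈epoch T l⌉₊ - 1) atTop atTop :=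
      (tendsto_sub_atTop_nat 1).comp
        (tendsto_nat_ceil_atTop.comp (tendsto_epoch_atTop hT_pos hT_lim))
    obtain ⟨L, hL⟩ := Metric.tendsto_atTop.mp (hlaw.comp hidx) (ε / 2) (half_pos hε)
    -- The threshold a may be negative, whereas a delay must not be. After it, ε/2 bounds the
    -- distance from the real to the copied virtual law, and ε/2 the distance from that law to the
    -- Gibbs one.
    refine ⟨max a 0, le_max_right _ _, L, fun l hl τ h h' => ?_⟩
    have ha' := le_max_left a 0
    have ha0 := le_max_right a 0
    have h1 := hR.abs_law_sub_le hC_meas hC_fin hrate hT_pos hreq B (by linarith) h'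
    have h2 := ha (τ - epoch T l) (by linarith)
    have h3 := hL l hl
    rw [Real.dist_eq] at h3
    have := abs_sub_le (g τ) (P.real {ω | V (⌈epoch T l⌉₊ - 1) ω = B}) q
    simp only [Function.comp] at h3
    linarith
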